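/- Let $\alpha\in(0,2]$ and $c>0$. For every $x\in(0,\pi)$ the (for $\alpha\le 1$ only conditionally convergent) two-sided series $$G_{\alpha,c}(x)=\frac1{2\pi}\sum_{n\in\mathbb Z}\frac{\cos(nx)}{c+|n|^\alpha}$$ converges, in the sense that its partial sums over $M\le n\le N$ have a limit as $M\to-\infty$ and $N\to+\infty$ independently. The function $G_{\alpha,c}$ is completely monotone on $(0,\pi)$: it is infinitely differentiable there and $(-1)^p G_{\alpha,c}^{(p)}(x)\ge 0$ for all integers $p\ge 0$ and all $x\in(0,\pi)$. Moreover, all these inequalities are strict: $(-1)^p G_{\alpha,c}^{(p)}(x)>0$ for all integers $p\ge 0$ and all $x\in(0,\pi)$. -/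

import Mathlib

open scoped ContDiff

/-- The periodic Green function `G_{α,c}(x) = (1/2π) ∑_{n ∈ ℤ} cos(nx) / (c + |n|^α)`.
The sum is the limit of the partial sums over `M ≤ n ≤ N` as `M → -∞` and `N → ∞`
independently: for `α ≤ 1` the series does not converge absolutely. -/
noncomputable def periodicGreen (α c x : ℝ) : ℝ :=
  (1 / (2 * Real.pi)) *
    ∑'[SummationFilter.conditional ℤ] n : ℤ, Real.cos (n * x) / (c + |(n : ℝ)| ^ α)

/-- `f` is completely monotone on the open set `s`: it is smooth there and its derivatives
alternate in sign, `(-1)^p f^{(p)} ≥ 0` on `s` for all `p ≥ 0`. -/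
def IsCompletelyMonotoneOn (f : ℝ → ℝ) (s : Set ℝ) : Prop :=
  ContDiffOn ℝ ∞ f s ∧ ∀ p : ℕ, ∀ x ∈ s, 0 ≤ (-1 : ℝ) ^ p * iteratedDeriv p f x

/-! The function s ↦ 1/(c + s^(α/2)) is a Stieltjes function, so there is a nonzero finite measure μ
with 1/(c + |n|^α) = ∫ u²/(u² + n²) dμ, where u = e^y (`exists_measure_integral_eq`). For fixed u
the cosine series of u²/(u² + n²) sums to πu cosh(u(π - x))/sinh(πu) (`hasSum_cos_mul_div`), whose
x-derivatives strictly alternate in sign on (0, π). Integrating against μ makes G a positive mixture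
of such kernels.

Two interchanges need bounds uniform in u. For sum and integral, `abs_sum_Icc_cos_mul_le` (Abel
summation) bounds the partial sums, which also gives conditional convergence; for derivative and
integral, `abs_greenKernel_le` bounds each derivative away from x = 0. For α < 2 the measure comes
from Cauchy's theorem on the strip |Im z| ≤ π/2; for α = 2 it is a point mass. -/

/-! ### Abel summation for cosine sums -/

/-- Abel's summation bound. -/
lemma abs_sum_mul_le_of_antitone {a b : ℕ → ℝ} {B : ℝ} (ha : Antitone a) (ha0 : ∀ n, 0 ≤ a n)
    (hB : ∀ n, |∑ i ∈ Finset.range n, b i| ≤ B) (n : ℕ) :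
    |∑ i ∈ Finset.range n, a i * b i| ≤ a 0 * B := by
  have hB0 : 0 ≤ B := (abs_nonneg _).trans (hB 0)
  have h := Finset.sum_range_by_parts a b n
  simp only [smul_eq_mul] at h
  rw [h]
  have h1 : |a (n - 1) * ∑ i ∈ Finset.range n, b i| ≤ a (n - 1) * B := by
    rw [abs_mul, abs_of_nonneg (ha0 _)]
    exact mul_le_mul_of_nonneg_left (hB n) (ha0 _)
  have h2 : |∑ i ∈ Finset.range (n - 1), (a (i + 1) - a i) * ∑ j ∈ Finset.range (i + 1), b j|
      ≤ (a 0 - a (n - 1)) * B := by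
    rw [← Finset.sum_range_sub', Finset.sum_mul]
    refine (Finset.abs_sum_le_sum_abs _ _).trans (Finset.sum_le_sum fun i _ => ?_)
    rw [abs_mul, abs_sub_comm, abs_of_nonneg (sub_nonneg.2 (ha (Nat.le_succ i)))]
    exact mul_le_mul_of_nonneg_left (hB _) (sub_nonneg.2 (ha (Nat.le_succ i)))
  refine (abs_sub _ _).trans ?_
  linarith

lemma two_mul_sin_half_mul_sum_cos (x : ℝ) (n : ℕ) :
    2 * Real.sin (x / 2) * ∑ i ∈ Finset.range n, Real.cos ((i + 1 : ℝ) * x) =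
      Real.sin ((n + 1 / 2) * x) - Real.sin (x / 2) := by
  induction n with
  | zero => simp; ring_nf
  | succ n ih =>
    rw [Finset.sum_range_succ, mul_add, ih]
    have h1 : ((n + 1 : ℕ) + 1 / 2 : ℝ) * x = (n + 1) * x + x / 2 := by push_cast; ring
    have h2 : (n + 1 / 2 : ℝ) * x = (n + 1) * x - x / 2 := by ring
    rw [h1, h2, Real.sin_add, Real.sin_sub]
    ring

lemma abs_sum_cos_le {x : ℝ} (hx : 0 < Real.sin (x / 2)) (n : ℕ) :
    |∑ i ∈ Finset.range n, Real.cos ((i + 1 : ℝ) * x)| ≤ 1 / Real.sin (x / 2) := by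
  rw [le_div_iff₀ hx]
  have h := two_mul_sin_half_mul_sum_cos x n
  have h2 : 2 * (|∑ i ∈ Finset.range n, Real.cos ((i + 1 : ℝ) * x)| * Real.sin (x / 2)) ≤ 2 := by
    rw [← abs_of_pos hx, ← abs_mul]
    have : |2 * ((∑ i ∈ Finset.range n, Real.cos ((i + 1 : ℝ) * x)) * Real.sin (x / 2))| ≤ 2 := by
      rw [show 2 * ((∑ i ∈ Finset.range n, Real.cos ((i + 1 : ℝ) * x)) * Real.sin (x / 2)) =
        Real.sin ((n + 1 / 2) * x) - Real.sin (x / 2) by rw [← h]; ring]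
      refine (abs_sub _ _).trans ?_
      linarith [Real.abs_sin_le_one ((n + 1 / 2) * x), Real.abs_sin_le_one (x / 2)]
    rwa [abs_mul, abs_of_pos (by norm_num : (0 : ℝ) < 2)] at this
  linarith

lemma sum_Icc_neg_of_even {f : ℤ → ℝ} (hf : ∀ n, f (-n) = f n) (a b : ℕ) :
    ∑ n ∈ Finset.Icc (-(a : ℤ)) b, f n =
      f 0 + ∑ i ∈ Finset.range a, f (i + 1) + ∑ i ∈ Finset.range b, f (i + 1) := by
  induction b with
  | zero =>
    induction a with
    | zero => simp
    | succ a ih =>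
      rw [Finset.sum_range_succ, ← hf (a + 1)]
      have : Finset.Icc (-((a + 1 : ℕ) : ℤ)) ((0 : ℕ) : ℤ) =
          insert (-((a : ℤ) + 1)) (Finset.Icc (-(a : ℤ)) ((0 : ℕ) : ℤ)) := by
        ext k; simp only [Finset.mem_Icc, Finset.mem_insert]; omega
      rw [this, Finset.sum_insert (by simp), ih]
      ring
  | succ b ih =>
    rw [Finset.sum_range_succ]
    have : Finset.Icc (-(a : ℤ)) ((b + 1 : ℕ) : ℤ) =
        insert ((b : ℤ) + 1) (Finset.Icc (-(a : ℤ)) (b : ℤ)) := by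
      ext k; simp only [Finset.mem_Icc, Finset.mem_insert]; omega
    rw [this, Finset.sum_insert (by simp), ih]
    ring

/-- The weights decrease in |n| and are at most 1, so Abel summation applies on each side of n = 0.
Independence of u, M and N makes this the dominating constant when μ is integrated. -/
lemma abs_sum_Icc_cos_mul_le {x u : ℝ} (hx : 0 < Real.sin (x / 2)) (hu : 0 < u) {M N : ℤ}
    (hM : M ≤ 0) (hN : 0 ≤ N) :
    |∑ n ∈ Finset.Icc M N, Real.cos (n * x) * (u ^ 2 / (u ^ 2 + (n : ℝ) ^ 2))| ≤
      1 + 2 / Real.sin (x / 2) := by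
  obtain ⟨b, rfl⟩ := Int.eq_ofNat_of_zero_le hN
  obtain ⟨a, ha⟩ := Int.eq_ofNat_of_zero_le (neg_nonneg.2 hM)
  obtain rfl : M = -(a : ℤ) := by omega
  rw [sum_Icc_neg_of_even (fun n => by simp)]
  have key (n : ℕ) : |∑ i ∈ Finset.range n, Real.cos (((i + 1 : ℤ) : ℝ) * x) *
      (u ^ 2 / (u ^ 2 + ((i + 1 : ℤ) : ℝ) ^ 2))| ≤ 1 / Real.sin (x / 2) := by
    have := abs_sum_mul_le_of_antitone (a := fun i : ℕ => u ^ 2 / (u ^ 2 + (i + 1 : ℝ) ^ 2))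
      (b := fun i : ℕ => Real.cos ((i + 1 : ℝ) * x)) (fun i j hij => by simp only; gcongr)
      (fun i => by positivity) (abs_sum_cos_le hx) n
    push_cast
    simp_rw [mul_comm (Real.cos _)]
    refine this.trans (mul_le_of_le_one_left (by positivity) ?_)
    rw [div_le_one (by positivity)]
    nlinarith
  have h0 : Real.cos (((0 : ℤ) : ℝ) * x) * (u ^ 2 / (u ^ 2 + ((0 : ℤ) : ℝ) ^ 2)) = 1 := by
    simp [hu.ne']
  rw [h0]
  refine (abs_add_three _ _ _).trans ?_
  have := key a
  have := key b
  rw [abs_one]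
  calc _ ≤ 1 + 1 / Real.sin (x / 2) + 1 / Real.sin (x / 2) := by gcongr
    _ = _ := by ring
-- The Fourier series of the hyperbolic cosine
open Complex in
lemma integral_exp_neg_mul_cosh {u : ℝ} (hu : 0 < u) (n : ℤ) :
    ∫ x in (0 : ℝ)..2 * Real.pi, cexp (-(I * n * x)) * (Real.cosh (u * (Real.pi - x)) : ℂ) =
      2 * u * Real.sinh (Real.pi * u) / (u ^ 2 + (n : ℂ) ^ 2) := by
  have hne1 : (u + I * n : ℂ) ≠ 0 := fun h => hu.ne' (by simpa using congrArg re h)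
  have hne2 : (u - I * n : ℂ) ≠ 0 := fun h => hu.ne' (by simpa using congrArg re h)
  have hne : (u ^ 2 + (n : ℂ) ^ 2) = (u + I * n : ℂ) * (u - I * n) := by
    ring_nf; rw [I_sq]; ring
  have h1 (x : ℝ) : cexp (-(I * n * x)) * (Real.cosh (u * (Real.pi - x)) : ℂ) =
      cexp (u * Real.pi) / 2 * cexp (-(u + I * n) * x) +
      cexp (-(u * Real.pi)) / 2 * cexp ((u - I * n) * x) := by
    push_cast
    rw [Complex.cosh, mul_div_assoc', mul_add, ← Complex.exp_add, ← Complex.exp_add, div_mul_eq_mul_div,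
      div_mul_eq_mul_div, ← Complex.exp_add, ← Complex.exp_add, add_div]
    congr 3 <;> ring
  simp_rw [h1]
  rw [intervalIntegral.integral_add (by apply Continuous.intervalIntegrable; fun_prop)
    (by apply Continuous.intervalIntegrable; fun_prop),
    intervalIntegral.integral_const_mul, intervalIntegral.integral_const_mul,
    integral_exp_mul_complex (neg_ne_zero.2 hne1), integral_exp_mul_complex hne2]
  have e1 : cexp (-(u + I * n) * (2 * Real.pi : ℝ)) = cexp (-(u * Real.pi)) * cexp (-(u * Real.pi)) := by
    rw [← Complex.exp_add, Complex.exp_eq_exp_iff_exists_int]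
    exact ⟨-n, by push_cast; ring⟩
  have e2 : cexp ((u - I * n) * (2 * Real.pi : ℝ)) = cexp (u * Real.pi) * cexp (u * Real.pi) := by
    rw [← Complex.exp_add, Complex.exp_eq_exp_iff_exists_int]
    exact ⟨-n, by push_cast; ring⟩
  have e3 : cexp (u * Real.pi) * cexp (-(u * Real.pi)) = 1 := by
    rw [← Complex.exp_add]; simp
  rw [e1, e2, hne]
  push_cast
  rw [Complex.sinh, mul_comm (Real.pi : ℂ) u]
  simp only [mul_zero, Complex.exp_zero]
  generalize cexp (u * Real.pi) = p at *
  generalize cexp (-(u * Real.pi)) = q at *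
  have e3' : q * p = 1 := by rw [mul_comm]; exact e3
  rw [show p / 2 * ((q * q - 1) / -(u + I * n)) + q / 2 * ((p * p - 1) / (u - I * n)) =
    ((p * q) * q - p) / (2 * -(u + I * n)) + ((q * p) * p - q) / (2 * (u - I * n)) by
      field_simp, e3, e3']
  field_simp
  ring

-- cosh(u(π - x)) agrees at 0 and 2π, so its periodization is continuous; its Fourier coefficients
-- are O(1/n²), hence summable, and the series converges pointwise to the function.
open Complex in
lemma hasSum_cos_mul_div {u : ℝ} (hu : 0 < u) {x : ℝ} (hx : x ∈ Set.Ioo 0 (2 * Real.pi)) :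
    HasSum (fun n : ℤ => Real.cos (n * x) * (u ^ 2 / (u ^ 2 + (n : ℝ) ^ 2)))
      (Real.pi * u * Real.cosh (u * (Real.pi - x)) / Real.sinh (Real.pi * u)) := by
  have hpi : 0 < 2 * Real.pi := Real.two_pi_pos
  have : Fact (0 < 2 * Real.pi) := ⟨hpi⟩
  have hsinh : 0 < Real.sinh (Real.pi * u) := Real.sinh_pos_iff.2 (by positivity)
  set g : ℝ → ℂ := fun x => (Real.cosh (u * (Real.pi - x)) : ℂ) with hg
  have hcont : Continuous (AddCircle.liftIco (2 * Real.pi) 0 g) := by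
    apply AddCircle.liftIco_zero_continuous
    · simp only [hg]
      rw [← Real.cosh_neg]
      congr 2
      ring
    · apply Continuous.continuousOn
      fun_prop
  let F : C(AddCircle (2 * Real.pi), ℂ) := ⟨_, hcont⟩
  have hcoeff (n : ℤ) : fourierCoeff F n =
      ((u * Real.sinh (Real.pi * u) / Real.pi / (u ^ 2 + (n : ℝ) ^ 2) : ℝ) : ℂ) := by
    change fourierCoeff (AddCircle.liftIco (2 * Real.pi) 0 g) n = _
    rw [fourierCoeff_liftIco_eq, fourierCoeffOn_eq_integral]
    have : ∀ y : ℝ, fourier (-n) (y : AddCircle (0 + 2 * Real.pi - 0)) • g y =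
        cexp (-(I * n * y)) * (Real.cosh (u * (Real.pi - y)) : ℂ) := by
      intro y
      rw [fourier_coe_apply, smul_eq_mul]
      congr 2
      have : (Real.pi : ℂ) ≠ 0 := by exact_mod_cast Real.pi_ne_zero
      push_cast
      field_simp
      ring
    simp_rw [this]
    rw [zero_add, integral_exp_neg_mul_cosh hu]
    have : (Real.pi : ℂ) ≠ 0 := by exact_mod_cast Real.pi_ne_zero
    rw [real_smul]
    push_cast
    field_simp
    ring
  have hsum : Summable (fourierCoeff F) := by
    have h0 : Summable (fun n : ℤ => u * Real.sinh (Real.pi * u) / Real.pi / (u ^ 2 + (n : ℝ) ^ 2)) := by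
      have h2 := (Real.summable_one_div_int_pow (p := 2)).2 one_lt_two
      refine Summable.of_norm_bounded_eventually
        (h2.mul_left (u * Real.sinh (Real.pi * u) / Real.pi)) ?_
      filter_upwards [(Set.finite_singleton (0 : ℤ)).compl_mem_cofinite] with n hn
      have hn' : (n : ℝ) ≠ 0 := by simpa using hn
      have hn2 : 0 < (n : ℝ) ^ 2 := by positivity
      rw [Real.norm_of_nonneg (by positivity), div_eq_mul_one_div]
      gcongr
      nlinarith
    have := hasSum_ofReal.2 h0.hasSum
    exact this.summable.congr fun n => (hcoeff n).symm
  have h := has_pointwise_sum_fourier_series_of_summable hsum (x : AddCircle (2 * Real.pi))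
  have hF : F (x : AddCircle (2 * Real.pi)) = g x := by
    change AddCircle.liftIco (2 * Real.pi) 0 g (x : AddCircle (2 * Real.pi)) = g x
    exact AddCircle.liftIco_coe_apply (by simpa using Set.Ioo_subset_Ico_self hx)
  rw [hF] at h
  have h' := (h.mapL reCLM).mul_left (Real.pi * u / Real.sinh (Real.pi * u))
  have hval : Real.pi * u / Real.sinh (Real.pi * u) * reCLM (g x) =
      Real.pi * u * Real.cosh (u * (Real.pi - x)) / Real.sinh (Real.pi * u) := by
    simp only [hg, reCLM_apply, ofReal_re]; ring
  rw [hval] at h'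
  refine h'.congr_fun fun n => ?_
  rw [hcoeff, fourier_coe_apply, smul_eq_mul, reCLM_apply, re_ofReal_mul]
  have : (2 * Real.pi * I * n * x / (2 * Real.pi : ℝ) : ℂ) = ((n * x : ℝ) : ℂ) * I := by
    have : (Real.pi : ℂ) ≠ 0 := by exact_mod_cast Real.pi_ne_zero
    push_cast
    field_simp
  rw [this, exp_ofReal_mul_I_re]
  field_simp

/-! ### The kernel and its derivatives -/

/-- The `p`-th derivative in `x` of `u * cosh (u * (π - x)) / (2 * sinh (π * u))`. -/
noncomputable def greenKernel (p : ℕ) (u x : ℝ) : ℝ :=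
  (-1) ^ p * (u ^ (p + 1) * (Real.exp (u * (Real.pi - x)) +
    (-1) ^ p * Real.exp (-(u * (Real.pi - x)))) / (4 * Real.sinh (Real.pi * u)))

lemma greenKernel_zero (u x : ℝ) :
    greenKernel 0 u x = u * Real.cosh (u * (Real.pi - x)) / (2 * Real.sinh (Real.pi * u)) := by
  simp only [greenKernel, Real.cosh_eq]
  ring

lemma hasDerivAt_greenKernel (p : ℕ) (u x : ℝ) :
    HasDerivAt (greenKernel p u) (greenKernel (p + 1) u x) x := by
  have h0 : HasDerivAt (fun x => u * (Real.pi - x)) (-u) x := by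
    simpa using ((hasDerivAt_id x).const_sub Real.pi).const_mul u
  have h := ((((h0.exp.add (h0.neg.exp.const_mul ((-1) ^ p))).const_mul (u ^ (p + 1))).div_const
    (4 * Real.sinh (Real.pi * u))).const_mul ((-1) ^ p))
  convert! h using 1
  simp only [greenKernel, Pi.neg_apply]
  ring

lemma neg_one_pow_mul_greenKernel_pos (p : ℕ) {u x : ℝ} (hu : 0 < u) (hx : x < Real.pi) :
    0 < (-1) ^ p * greenKernel p u x := by
  have hsinh : 0 < Real.sinh (Real.pi * u) := Real.sinh_pos_iff.2 (mul_pos Real.pi_pos hu)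
  have hz : 0 < u * (Real.pi - x) := mul_pos hu (sub_pos.2 hx)
  have hlt : Real.exp (-(u * (Real.pi - x))) < Real.exp (u * (Real.pi - x)) :=
    Real.exp_lt_exp.2 (by linarith)
  have hpos := Real.exp_pos (-(u * (Real.pi - x)))
  rw [greenKernel, ← mul_assoc, ← mul_pow, neg_one_mul, neg_neg, one_pow, one_mul]
  refine div_pos (mul_pos (by positivity) ?_) (by positivity)
  rcases neg_one_pow_eq_or ℝ p with h | h <;> rw [h] <;> linarith

/-- Up to constants the kernel is at most u^(p+1) e^(-au)/(1 - e^(-2πu)). Using 1 - e^(-v) ≥ v/(1 +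
v) at v = 2πu leaves u^p e^(-au) and u^(p+1) e^(-au), each controlled by u^n e^(-au) ≤ n!/a^n. The
bound is free of u, so any finite measure will do. -/
lemma abs_greenKernel_le (p : ℕ) {a u x : ℝ} (ha : 0 < a) (hu : 0 < u)
    (hx : x ∈ Set.Ioo a Real.pi) :
    |greenKernel p u x| ≤ p.factorial / a ^ p + (p + 1).factorial / a ^ (p + 1) := by
  have hsinh : 0 < Real.sinh (Real.pi * u) :=
    Real.sinh_pos_iff.2 (mul_pos Real.pi_pos hu)
  have hpow (n : ℕ) : u ^ n ≤ n.factorial / a ^ n * Real.exp (a * u) := by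
    have h := Real.pow_div_factorial_le_exp (a * u) (by positivity) n
    rw [div_le_iff₀ (by positivity), mul_pow] at h
    rw [div_mul_eq_mul_div, le_div_iff₀ (by positivity)]
    linarith
  set C : ℝ := p.factorial / a ^ p + (p + 1).factorial / a ^ (p + 1) with hC
  have hC0 : 0 ≤ C := by positivity
  have hpi := Real.two_le_pi
  have h1 : u ^ (p + 1) * (1 + 2 * Real.pi * u) ≤ 2 * Real.pi * u * (C * Real.exp (a * u)) := by
    have hp := hpow p
    have hp1 := hpow (p + 1)
    have e : u ^ (p + 1) * (1 + 2 * Real.pi * u) =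
        u * (u ^ p + 2 * Real.pi * u ^ (p + 1)) := by ring
    rw [e, hC, mul_comm (2 * Real.pi) u, mul_assoc u]
    refine mul_le_mul_of_nonneg_left ?_ hu.le
    have : u ^ p ≤ 2 * Real.pi * u ^ p := le_mul_of_one_le_left (by positivity) (by linarith)
    nlinarith [mul_le_mul_of_nonneg_left hp (by positivity : 0 ≤ 2 * Real.pi),
      mul_le_mul_of_nonneg_left hp1 (by positivity : 0 ≤ 2 * Real.pi)]
  have h2 : 2 * Real.pi * u ≤ (1 + 2 * Real.pi * u) * (1 - Real.exp (-(2 * Real.pi * u))) := by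
    have h := Real.add_one_le_exp (2 * Real.pi * u)
    have : (1 + 2 * Real.pi * u) * Real.exp (-(2 * Real.pi * u)) ≤ 1 := by
      rw [Real.exp_neg, ← div_eq_mul_inv, div_le_one (Real.exp_pos _)]
      linarith
    linarith
  have h3 : u ^ (p + 1) ≤ C * Real.exp (a * u) * (1 - Real.exp (-(2 * Real.pi * u))) := by
    have h0 : 0 < 1 + 2 * Real.pi * u := by positivity
    refine le_of_mul_le_mul_right ?_ h0
    calc _ ≤ _ := h1
      _ ≤ (1 + 2 * Real.pi * u) * (1 - Real.exp (-(2 * Real.pi * u))) * (C * Real.exp (a * u)) := by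
        gcongr
      _ = _ := by ring
  have h4 : u ^ (p + 1) * Real.exp (u * (Real.pi - a)) ≤ C * (2 * Real.sinh (Real.pi * u)) := by
    calc _ ≤ C * Real.exp (a * u) * (1 - Real.exp (-(2 * Real.pi * u))) *
          Real.exp (u * (Real.pi - a)) := by gcongr
      _ = C * (Real.exp (a * u) * Real.exp (u * (Real.pi - a)) - Real.exp (a * u) *
          Real.exp (-(2 * Real.pi * u)) * Real.exp (u * (Real.pi - a))) := by ring
      _ = _ := by
        rw [← Real.exp_add, ← Real.exp_add, ← Real.exp_add, Real.sinh_eq]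
        ring_nf
  rw [greenKernel, abs_mul, abs_pow, abs_neg, abs_one, one_pow, one_mul, abs_div,
    abs_of_pos (by positivity : 0 < 4 * Real.sinh (Real.pi * u)), div_le_iff₀ (by positivity),
    abs_mul, abs_of_pos (by positivity : 0 < u ^ (p + 1))]
  have h5 : |Real.exp (u * (Real.pi - x)) + (-1) ^ p * Real.exp (-(u * (Real.pi - x)))| ≤
      2 * Real.exp (u * (Real.pi - a)) := by
    refine (abs_add_le _ _).trans ?_
    rw [abs_mul, abs_pow, abs_neg, abs_one, one_pow, one_mul, Real.abs_exp, Real.abs_exp]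
    have hxa := hx.1
    have hxp := hx.2
    have e1 : Real.exp (u * (Real.pi - x)) ≤ Real.exp (u * (Real.pi - a)) := by gcongr
    have e2 : Real.exp (-(u * (Real.pi - x))) ≤ Real.exp (u * (Real.pi - a)) :=
      Real.exp_le_exp.2 (by nlinarith [mul_pos hu (sub_pos.2 hxp), mul_pos hu (sub_pos.2 hxa)])
    linarith
  calc _ ≤ u ^ (p + 1) * (2 * Real.exp (u * (Real.pi - a))) := by gcongr
    _ = 2 * (u ^ (p + 1) * Real.exp (u * (Real.pi - a))) := by ring
    _ ≤ 2 * (C * (2 * Real.sinh (Real.pi * u))) := by gcongr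
    _ = _ := by ring

lemma measurable_greenKernel_exp (p : ℕ) (x : ℝ) :
    Measurable fun y => greenKernel p (Real.exp y) x := by
  have : Measurable Real.sinh := Real.continuous_sinh.measurable
  unfold greenKernel
  fun_prop

/-! ### Integrating the kernel against a finite measure -/

open MeasureTheory Filter Topology

lemma integrable_greenKernel_exp (μ : Measure ℝ) [IsFiniteMeasure μ] (p : ℕ) {x : ℝ}
    (hx : x ∈ Set.Ioo 0 Real.pi) : Integrable (fun y => greenKernel p (Real.exp y) x) μ :=
  .of_bound (measurable_greenKernel_exp p x).aestronglyMeasurable _ <| .of_forall fun y =>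
    abs_greenKernel_le p (half_pos hx.1) (Real.exp_pos y) ⟨half_lt_self hx.1, hx.2⟩

lemma hasDerivAt_integral_greenKernel (μ : Measure ℝ) [IsFiniteMeasure μ] (p : ℕ) {x : ℝ}
    (hx : x ∈ Set.Ioo 0 Real.pi) :
    HasDerivAt (fun x => ∫ y, greenKernel p (Real.exp y) x ∂μ)
      (∫ y, greenKernel (p + 1) (Real.exp y) x ∂μ) x :=
  (hasDerivAt_integral_of_dominated_loc_of_deriv_le
    (F := fun x y => greenKernel p (Real.exp y) x)
    (F' := fun x y => greenKernel (p + 1) (Real.exp y) x)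
    (Ioo_mem_nhds (half_lt_self hx.1) hx.2)
    (.of_forall fun x => (measurable_greenKernel_exp p x).aestronglyMeasurable)
    (integrable_greenKernel_exp μ p hx)
    (measurable_greenKernel_exp (p + 1) x).aestronglyMeasurable
    (.of_forall fun y _ hz => abs_greenKernel_le (p + 1) (half_pos hx.1) (Real.exp_pos y) hz)
    (integrable_const _)
    (.of_forall fun y z _ => hasDerivAt_greenKernel p (Real.exp y) z)).2

lemma neg_one_pow_mul_integral_greenKernel_pos (μ : Measure ℝ) [IsFiniteMeasure μ] (hμ : μ ≠ 0)
    (p : ℕ) {x : ℝ} (hx : x ∈ Set.Ioo 0 Real.pi) :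
    0 < (-1) ^ p * ∫ y, greenKernel p (Real.exp y) x ∂μ := by
  have hpos (y : ℝ) := neg_one_pow_mul_greenKernel_pos p (Real.exp_pos y) hx.2
  rw [← integral_const_mul, integral_pos_iff_support_of_nonneg (fun y => (hpos y).le)
    ((integrable_greenKernel_exp μ p hx).const_mul _)]
  rw [Function.support_eq_univ fun y => (hpos y).ne']
  exact Measure.measure_univ_pos.2 hμ

/-- A sequence of functions each of which is the derivative of the preceding one consists of the
iterated derivatives of its first member. -/
lemma iteratedDeriv_eq_of_hasDerivAt {F : ℕ → ℝ → ℝ} {s : Set ℝ} (hs : IsOpen s)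
    (hF : ∀ p, ∀ x ∈ s, HasDerivAt (F p) (F (p + 1) x) x) {f : ℝ → ℝ} (hf : Set.EqOn f (F 0) s)
    (p : ℕ) : Set.EqOn (iteratedDeriv p f) (F p) s := by
  induction p with
  | zero => simpa using hf
  | succ p ih =>
    intro x hx
    rw [iteratedDeriv_succ, (ih.eventuallyEq_of_mem (hs.mem_nhds hx)).deriv_eq]
    exact (hF p x hx).deriv

lemma contDiffOn_infty_of_hasDerivAt {F : ℕ → ℝ → ℝ} {s : Set ℝ} (hs : IsOpen s)
    (hF : ∀ p, ∀ x ∈ s, HasDerivAt (F p) (F (p + 1) x) x) : ContDiffOn ℝ ∞ (F 0) s := by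
  have key (n : ℕ) : ∀ p, ContDiffOn ℝ n (F p) s := by
    induction n with
    | zero => exact fun p => contDiffOn_zero.2 fun x hx => (hF p x hx).continuousAt.continuousWithinAt
    | succ n ih =>
      intro p
      push_cast
      rw [contDiffOn_succ_iff_deriv_of_isOpen hs]
      exact ⟨fun x hx => (hF p x hx).differentiableAt.differentiableWithinAt, by simp,
        (ih (p + 1)).congr fun x hx => (hF p x hx).deriv⟩
  exact contDiffOn_infty.2 fun n => key n 0

lemma hasSum_conditional_cos_mul {μ : Measure ℝ} [IsFiniteMeasure μ] {a : ℤ → ℝ}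
    (ha : ∀ n : ℤ, ∫ y, Real.exp y ^ 2 / (Real.exp y ^ 2 + (n : ℝ) ^ 2) ∂μ = a n) {x : ℝ}
    (hx : x ∈ Set.Ioo 0 Real.pi) :
    HasSum (fun n : ℤ => Real.cos (n * x) * a n)
      (2 * Real.pi * ∫ y, greenKernel 0 (Real.exp y) x ∂μ) (SummationFilter.conditional ℤ) := by
  have hsin : 0 < Real.sin (x / 2) :=
    Real.sin_pos_of_pos_of_lt_pi (half_pos hx.1) (by linarith [hx.1, hx.2])
  have hmeas (n : ℤ) : Measurable fun y => Real.exp y ^ 2 / (Real.exp y ^ 2 + (n : ℝ) ^ 2) := by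
    fun_prop
  have hint (n : ℤ) : Integrable (fun y => Real.exp y ^ 2 / (Real.exp y ^ 2 + (n : ℝ) ^ 2)) μ := by
    refine .of_bound (hmeas n).aestronglyMeasurable 1 (.of_forall fun y => ?_)
    rw [Real.norm_of_nonneg (by positivity), div_le_one (by positivity)]
    nlinarith
  have hsum (s : Finset ℤ) : ∑ n ∈ s, Real.cos (n * x) * a n =
      ∫ y, ∑ n ∈ s, Real.cos (n * x) * (Real.exp y ^ 2 / (Real.exp y ^ 2 + (n : ℝ) ^ 2)) ∂μ := by
    rw [integral_finsetSum _ fun n _ => (hint n).const_mul _]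
    simp_rw [integral_const_mul, ha]
  rw [HasSum, ← integral_const_mul]
  simp_rw [hsum]
  refine tendsto_integral_filter_of_dominated_convergence (fun _ => 1 + 2 / Real.sin (x / 2))
    (.of_forall fun s => (Finset.measurable_sum s fun n _ =>
      (hmeas n).const_mul _).aestronglyMeasurable) ?_ (integrable_const _) (.of_forall fun y => ?_)
  · rw [SummationFilter.conditional_filter, eventually_map]
    filter_upwards [prod_mem_prod (eventually_le_atBot 0) (eventually_ge_atTop 0)] with p hp
    exact .of_forall fun y => abs_sum_Icc_cos_mul_le hsin (Real.exp_pos y) hp.1 hp.2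
  -- For each fixed y the series converges unconditionally, so in particular along integer
  -- intervals.
  · have h := hasSum_cos_mul_div (Real.exp_pos y) (x := x) ⟨hx.1, by linarith [hx.2, Real.pi_pos]⟩
    rw [greenKernel_zero]
    convert! h.mono_left (SummationFilter.conditional ℤ).le_atTop using 2
    ring

/-! ### Cauchy's theorem on a horizontal strip -/

open Complex in
lemma tendsto_integral_vertical {q : ℂ → ℂ} {a b : ℝ} {l : Filter ℝ} [l.IsCountablyGenerated]
    (hq : ContinuousOn q {z | z.im ∈ Set.uIcc a b}) {w : ℂ}
    (h : Tendsto q (comap re l) (𝓝 w)) :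
    Tendsto (fun R : ℝ => ∫ y : ℝ in a..b, q (R + y * I)) l (𝓝 ((b - a) * w)) := by
  have hbd : ∀ᶠ z in comap re l, ‖q z‖ ≤ ‖w‖ + 1 :=
    (h.norm.eventually (gt_mem_nhds (lt_add_one ‖w‖))).mono fun _ hz => hz.le
  rw [eventually_comap] at hbd
  have h1 := intervalIntegral.tendsto_integral_filter_of_dominated_convergence (a := a) (b := b)
    (μ := volume) (l := l) (F := fun R y => q (R + y * I)) (f := fun _ => w)
    (fun _ => ‖w‖ + 1) (.of_forall fun R => ?_) (hbd.mono fun R hR => .of_forall fun y _ =>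
      hR _ (by simp)) (by simp) (.of_forall fun y _ => h.comp (tendsto_comap_iff.2 ?_))
  · simpa using h1
  · refine ContinuousOn.aestronglyMeasurable (hq.comp (by fun_prop) fun y hy => ?_)
      measurableSet_uIoc
    simpa using Set.uIoc_subset_uIcc hy
  · simpa [Function.comp_def] using! tendsto_id

-- Apply Cauchy's theorem to the rectangle with vertices ±R ± iθ. Limits along `comap re` are
-- uniform in the imaginary part, so the right side tends to its length 2θ times w and the left side
-- to 0.
open Complex in
lemma tendsto_integral_sub_of_strip {q : ℂ → ℂ} {θ : ℝ}
    (hq : DifferentiableOn ℂ q {z | z.im ∈ Set.uIcc (-θ) θ}) {w : ℂ}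
    (htop : Tendsto q (comap re atTop) (𝓝 w)) (hbot : Tendsto q (comap re atBot) (𝓝 0)) :
    Tendsto (fun R : ℝ => ∫ x : ℝ in -R..R, (q (x + (-θ : ℝ) * I) - q (x + θ * I))) atTop
      (𝓝 (-(2 * θ * w * I))) := by
  have hr := tendsto_integral_vertical hq.continuousOn htop
  have hl := (tendsto_integral_vertical hq.continuousOn hbot).comp tendsto_neg_atTop_atBot
  have hint {t : ℝ} (ht : t ∈ Set.uIcc (-θ) θ) (R : ℝ) :
      IntervalIntegrable (fun x : ℝ => q (x + t * I)) volume (-R) R := by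
    apply Continuous.intervalIntegrable
    exact hq.continuousOn.comp_continuous (by fun_prop) fun x => by simpa using ht
  have hrect (R : ℝ) : ∫ x : ℝ in -R..R, (q (x + (-θ : ℝ) * I) - q (x + θ * I)) =
      -(I * ∫ y : ℝ in -θ..θ, q (R + y * I)) + I * ∫ y : ℝ in -θ..θ, q ((-R : ℝ) + y * I) := by
    have := integral_boundary_rect_eq_zero_of_differentiableOn q (⟨-R, -θ⟩ : ℂ) (⟨R, θ⟩ : ℂ)
      (hq.mono fun z hz => (mem_reProdIm.1 hz).2)
    simp only [smul_eq_mul] at this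
    rw [intervalIntegral.integral_sub (hint (by simp) R) (hint (by simp) R)]
    linear_combination this
  simp_rw [hrect]
  have e : (-(2 * θ * w * I) : ℂ) =
      -(I * ((θ - (-θ : ℝ)) * w)) + I * ((θ - (-θ : ℝ)) * 0) := by
    push_cast
    ring
  rw [e]
  exact (hr.const_mul I).neg.add (hl.const_mul I)

open Complex in
lemma tendsto_mul_comap_re {k : ℝ} (hk : 0 < k) :
    Tendsto (fun z : ℂ => (k : ℂ) * z) (comap re atTop) (comap re atTop) ∧
    Tendsto (fun z : ℂ => (k : ℂ) * z) (comap re atBot) (comap re atBot) := by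
  constructor <;> rw [tendsto_comap_iff]
  · simpa [Function.comp_def] using tendsto_comap.const_mul_atTop hk
  · simpa [Function.comp_def] using tendsto_comap.const_mul_atBot hk

open Complex Bornology in
lemma tendsto_contour_integrand_atTop {α c A m : ℝ} (hα : 0 < α) :
    Tendsto (fun z : ℂ => (1 / (c + cexp (α * z)) - A) *
      (cexp ((2 : ℝ) * z) / (cexp ((2 : ℝ) * z) - (m : ℂ) ^ 2))) (comap re atTop) (𝓝 (-A : ℂ)) := by
  have h1 := tendsto_exp_comap_re_atTop.comp (tendsto_mul_comap_re hα).1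
  have h2 := tendsto_exp_comap_re_atTop.comp (tendsto_mul_comap_re two_pos).1
  have h3 : Tendsto (fun w : ℂ => 1 / (c + w)) (cobounded ℂ) (𝓝 0) := by
    simpa [Function.comp_def] using tendsto_inv₀_cobounded.comp (tendsto_const_add_cobounded (c : ℂ))
  have h4 : Tendsto (fun w : ℂ => w / (w - (m : ℂ) ^ 2)) (cobounded ℂ) (𝓝 1) := by
    have : Tendsto (fun w : ℂ => (1 - (m : ℂ) ^ 2 * w⁻¹)⁻¹) (cobounded ℂ) (𝓝 1) := by
      simpa using ((tendsto_inv₀_cobounded.const_mul ((m : ℂ) ^ 2)).const_sub 1).inv₀ (by simp)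
    refine this.congr' ?_
    filter_upwards [eventually_ne_cobounded (0 : ℂ)] with w hw
    rw [← inv_div, sub_div, div_self hw, div_eq_mul_inv]
  simpa [Function.comp_def] using ((h3.comp h1).sub_const (A : ℂ)).mul (h4.comp h2)

-- If m ≠ 0 the second factor vanishes in the limit; if m = 0 it is identically 1, and A = 1/c makes
-- the first factor vanish.
open Complex in
lemma tendsto_contour_integrand_atBot {α c A m : ℝ} (hα : 0 < α) (hc : 0 < c)
    (hm : m ≠ 0 ∨ A = 1 / c) :
    Tendsto (fun z : ℂ => (1 / (c + cexp (α * z)) - A) *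
      (cexp ((2 : ℝ) * z) / (cexp ((2 : ℝ) * z) - (m : ℂ) ^ 2))) (comap re atBot) (𝓝 0) := by
  have hc' : (c : ℂ) ≠ 0 := by exact_mod_cast hc.ne'
  have h1 : Tendsto (fun z : ℂ => 1 / (c + cexp (α * z)) - A) (comap re atBot)
      (𝓝 (1 / c - A)) := by
    have := (tendsto_exp_comap_re_atBot.comp (tendsto_mul_comap_re hα).2).const_add (c : ℂ)
    rw [add_zero] at this
    simpa [Function.comp_def] using (this.inv₀ hc').sub_const (A : ℂ)
  have h2 := tendsto_exp_comap_re_atBot.comp (tendsto_mul_comap_re two_pos).2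
  by_cases hm0 : m = 0
  · have hA : A = 1 / c := hm.resolve_left (not_not.2 hm0)
    simpa [hm0, hA] using h1
  · have hm' : (0 : ℂ) - (m : ℂ) ^ 2 ≠ 0 := by simpa using hm0
    simpa [Function.comp_def] using h1.mul (h2.div (h2.sub_const ((m : ℂ) ^ 2)) hm')

/-! ### The Stieltjes representation -/

/-- Up to normalization, the jump of `1 / (c + s ^ (α / 2))` across the negative real axis, in the
variable `y = log |s| / 2`. -/
noncomputable def stieltjesDensity (α c y : ℝ) : ℝ :=
  2 / Real.pi * (Real.exp (α * y) * Real.sin (α * (Real.pi / 2))) /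
    (c ^ 2 + 2 * c * Real.exp (α * y) * Real.cos (α * (Real.pi / 2)) + Real.exp (α * y) ^ 2)

/-- With φ = απ/2 this is |c + e^(αy + iφ)|², whose imaginary part e^(αy) sin φ is nonzero because 0
< φ < π. -/
lemma stieltjesDensity_denom_pos {α c : ℝ} (hα : α ∈ Set.Ioo 0 2) (y : ℝ) :
    0 < c ^ 2 + 2 * c * Real.exp (α * y) * Real.cos (α * (Real.pi / 2)) + Real.exp (α * y) ^ 2 := by
  have hs : 0 < Real.sin (α * (Real.pi / 2)) := Real.sin_pos_of_pos_of_lt_pi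
    (mul_pos hα.1 Real.pi_div_two_pos) (by nlinarith [hα.2, Real.pi_pos])
  have h := Real.sin_sq_add_cos_sq (α * (Real.pi / 2))
  have := mul_pos (Real.exp_pos (α * y)) hs
  nlinarith [sq_nonneg (c + Real.exp (α * y) * Real.cos (α * (Real.pi / 2))), pow_pos this 2]

lemma stieltjesDensity_nonneg {α : ℝ} (c : ℝ) (hα : α ∈ Set.Ioo 0 2) (y : ℝ) :
    0 ≤ stieltjesDensity α c y := by
  have hs : 0 < Real.sin (α * (Real.pi / 2)) := Real.sin_pos_of_pos_of_lt_pi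
    (mul_pos hα.1 Real.pi_div_two_pos) (by nlinarith [hα.2, Real.pi_pos])
  have := stieltjesDensity_denom_pos (c := c) hα y
  have := Real.pi_pos
  unfold stieltjesDensity
  positivity

lemma continuous_stieltjesDensity {α : ℝ} (c : ℝ) (hα : α ∈ Set.Ioo 0 2) :
    Continuous (stieltjesDensity α c) := by
  unfold stieltjesDensity
  exact Continuous.div (by fun_prop) (by fun_prop) fun y => (stieltjesDensity_denom_pos hα y).ne'

open Complex in
lemma one_div_sub_one_div_eq_stieltjesDensity {α c : ℝ} (hα : α ∈ Set.Ioo 0 2) (y : ℝ) :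
    1 / (c + cexp (α * (y + (-(Real.pi / 2) : ℝ) * I))) -
      1 / (c + cexp (α * (y + (Real.pi / 2 : ℝ) * I))) =
      Real.pi * I * stieltjesDensity α c y := by
  set φ : ℝ := α * (Real.pi / 2) with hφ
  have e1 : cexp (α * (y + (-(Real.pi / 2) : ℝ) * I)) =
      Real.exp (α * y) * (Real.cos φ - Real.sin φ * I) := by
    rw [show (α * (y + (-(Real.pi / 2) : ℝ) * I) : ℂ) = (α * y : ℝ) + ((-φ : ℝ) : ℂ) * I by
      rw [hφ]; push_cast; ring, Complex.exp_add, ← ofReal_exp, exp_mul_I, ← ofReal_cos,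
      ← ofReal_sin, Real.cos_neg, Real.sin_neg]
    push_cast; ring
  have e2 : cexp (α * (y + (Real.pi / 2 : ℝ) * I)) =
      Real.exp (α * y) * (Real.cos φ + Real.sin φ * I) := by
    rw [show (α * (y + (Real.pi / 2 : ℝ) * I) : ℂ) = (α * y : ℝ) + (φ : ℂ) * I by
      rw [hφ]; push_cast; ring, Complex.exp_add, ← ofReal_exp, exp_mul_I, ← ofReal_cos,
      ← ofReal_sin]
  have hd := stieltjesDensity_denom_pos (c := c) hα y
  rw [← hφ] at hd
  rw [e1, e2, stieltjesDensity, ← hφ]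
  have hsc := Real.sin_sq_add_cos_sq φ
  generalize Real.exp (α * y) = E at *
  generalize Real.cos φ = C at *
  generalize Real.sin φ = S at *
  have hsc' : (S : ℂ) ^ 2 + (C : ℂ) ^ 2 = 1 := by exact_mod_cast hsc
  have hprod : (c + E * (C - S * I) : ℂ) * (c + E * (C + S * I)) =
      ((c ^ 2 + 2 * c * E * C + E ^ 2 : ℝ) : ℂ) := by
    push_cast
    linear_combination (E : ℂ) ^ 2 * hsc' - (E : ℂ) ^ 2 * (S : ℂ) ^ 2 * I_sq
  have hd' : ((c ^ 2 + 2 * c * E * C + E ^ 2 : ℝ) : ℂ) ≠ 0 := by exact_mod_cast hd.ne'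
  rw [← hprod] at hd'
  have hne1 := left_ne_zero_of_mul hd'
  have hne2 := right_ne_zero_of_mul hd'
  have hpi : (Real.pi : ℂ) ≠ 0 := by exact_mod_cast Real.pi_ne_zero
  rw [div_sub_div _ _ hne1 hne2, ofReal_div, ← hprod, mul_div_assoc']
  congr 1
  push_cast
  field_simp
  ring

-- On both edges Im z = ±π/2 one has e^(2z) = -e^(2y), so the rational factor is the same real
-- number on each, A cancels in the difference, and the jump of 1/(c + e^(αz)) remains. A survives
-- only through the limit -A at the right end.
open Complex Bornology in
lemma tendsto_integral_stieltjesDensity_of_extension {α c A m : ℝ} (hα : α ∈ Set.Ioo 0 2)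
    (hc : 0 < c) {q : ℂ → ℂ}
    (hq : DifferentiableOn ℂ q {z | z.im ∈ Set.uIcc (-(Real.pi / 2)) (Real.pi / 2)})
    (hqe : ∀ z : ℂ, cexp ((2 : ℝ) * z) ≠ (m : ℂ) ^ 2 → q z = (1 / (c + cexp (α * z)) - A) *
      (cexp ((2 : ℝ) * z) / (cexp ((2 : ℝ) * z) - (m : ℂ) ^ 2)))
    (hm : m ≠ 0 ∨ A = 1 / c) :
    Tendsto (fun R : ℝ => ∫ y : ℝ in -R..R,
      stieltjesDensity α c y * (Real.exp y ^ 2 / (Real.exp y ^ 2 + m ^ 2))) atTop (𝓝 A) := by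
  have hpi : (Real.pi : ℂ) ≠ 0 := by exact_mod_cast Real.pi_ne_zero
  have htop : Tendsto q (comap re atTop) (𝓝 (-A : ℂ)) := by
    refine (tendsto_contour_integrand_atTop (c := c) (A := A) (m := m) hα.1).congr' ?_
    filter_upwards [(tendsto_exp_comap_re_atTop.comp (tendsto_mul_comap_re two_pos).1).eventually
      (eventually_ne_cobounded ((m : ℂ) ^ 2))] with z hz using (hqe z hz).symm
  have hbot : Tendsto q (comap re atBot) (𝓝 0) := by
    refine (tendsto_contour_integrand_atBot hα.1 hc hm).congr' ?_
    have h : ∀ᶠ w in 𝓝[≠] (0 : ℂ), w ≠ (m : ℂ) ^ 2 := by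
      by_cases hm0 : (m : ℂ) ^ 2 = 0
      · rw [hm0]; exact self_mem_nhdsWithin
      · exact nhdsWithin_le_nhds (isOpen_ne.mem_nhds (Ne.symm hm0))
    filter_upwards [(tendsto_exp_comap_re_atBot_nhdsNE.comp
      (tendsto_mul_comap_re two_pos).2).eventually h] with z hz using (hqe z hz).symm
  have hlim := tendsto_integral_sub_of_strip hq htop hbot
  have hexp (y s : ℝ) (hs : s = Real.pi / 2 ∨ s = -(Real.pi / 2)) :
      cexp ((2 : ℝ) * (y + s * I)) = -((Real.exp y ^ 2 : ℝ) : ℂ) := by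
    have h2 : cexp (2 * s * I) = -1 := by
      rcases hs with rfl | rfl
      · rw [← exp_pi_mul_I]; congr 1; push_cast; ring
      · rw [← exp_neg_pi_mul_I]; congr 1; push_cast; ring
    rw [show (((2 : ℝ) : ℂ) * (y + s * I)) = y + y + 2 * s * I by push_cast; ring,
      Complex.exp_add, Complex.exp_add, h2]
    push_cast
    ring
  have hedge (y s : ℝ) (hs : s = Real.pi / 2 ∨ s = -(Real.pi / 2)) :
      q (y + s * I) = (1 / (c + cexp (α * (y + s * I))) - A) *
        ((Real.exp y ^ 2 / (Real.exp y ^ 2 + m ^ 2) : ℝ) : ℂ) := by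
    have hpos : 0 < Real.exp y ^ 2 + m ^ 2 := by positivity
    rw [hqe, hexp y s hs]
    · congr 1
      push_cast
      rw [← neg_div_neg_eq]
      congr 1 <;> ring
    · rw [hexp y s hs]
      intro h
      have : -(Real.exp y ^ 2) = m ^ 2 := by exact_mod_cast h
      linarith
  have hdiff (y : ℝ) : q (y + (-(Real.pi / 2) : ℝ) * I) - q (y + (Real.pi / 2 : ℝ) * I) =
      Real.pi * I * ((stieltjesDensity α c y *
        (Real.exp y ^ 2 / (Real.exp y ^ 2 + m ^ 2)) : ℝ) : ℂ) := by
    rw [hedge y _ (.inr rfl), hedge y _ (.inl rfl), ← sub_mul, sub_sub_sub_cancel_right,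
      one_div_sub_one_div_eq_stieltjesDensity hα]
    push_cast
    ring
  simp_rw [hdiff, intervalIntegral.integral_const_mul, intervalIntegral.integral_ofReal] at hlim
  have h := hlim.const_mul ((Real.pi * I : ℂ)⁻¹)
  have hpiI : (Real.pi * I : ℂ) ≠ 0 := mul_ne_zero hpi I_ne_zero
  have e : (Real.pi * I : ℂ)⁻¹ * -(2 * (Real.pi / 2 : ℝ) * (-A) * I) = A := by
    push_cast
    field_simp
  rw [e] at h
  simp_rw [inv_mul_cancel_left₀ hpiI] at h
  exact_mod_cast (continuous_re.tendsto _).comp h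

open Complex in
lemma add_exp_mul_ne_zero {α c : ℝ} (hα : α ∈ Set.Ioo 0 2) (hc : 0 < c) {z : ℂ}
    (hz : |z.im| < Real.pi / α) : (c + cexp (α * z) : ℂ) ≠ 0 := by
  intro h
  have h1 : cexp (α * z) = cexp (Real.log c + Real.pi * I) := by
    rw [Complex.exp_add, exp_pi_mul_I, ← ofReal_exp, Real.exp_log hc]
    linear_combination h
  obtain ⟨k, hk⟩ := exp_eq_exp_iff_exists_int.1 h1
  have him := congrArg im hk
  have him' : α * z.im = Real.pi + k * (2 * Real.pi) := by simpa using him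
  rw [lt_div_iff₀ hα.1, mul_comm, ← abs_of_pos hα.1, ← abs_mul, him', abs_lt] at hz
  have hpi := Real.pi_pos
  rcases le_or_gt 0 k with hk0 | hk0
  · have : (0 : ℝ) ≤ k := by exact_mod_cast hk0
    nlinarith [hz.2]
  · have : (k : ℝ) ≤ -1 := by exact_mod_cast Int.le_sub_one_of_lt hk0
    nlinarith [hz.1]

open Complex in
lemma tendsto_integral_stieltjesDensity {α c m : ℝ} (hα : α ∈ Set.Ioo 0 2) (hc : 0 < c)
    (hm : 0 ≤ m) :
    Tendsto (fun R : ℝ => ∫ y : ℝ in -R..R,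
      stieltjesDensity α c y * (Real.exp y ^ 2 / (Real.exp y ^ 2 + m ^ 2))) atTop
      (𝓝 (1 / (c + m ^ α))) := by
  -- Below π/α the denominator c + e^(αz) has no zero; below π the only solution of e^(2z) = m² is
  -- log m. Both exceed π/2, the second because α < 2.
  set ρ : ℝ := min Real.pi (Real.pi / α)
  have hρ : Real.pi / 2 < ρ := lt_min (half_lt_self Real.pi_pos)
    (div_lt_div_of_pos_left Real.pi_pos hα.1 hα.2)
  set U : Set ℂ := {z | |z.im| < ρ} with hU
  have hUo : IsOpen U := isOpen_lt (by fun_prop) continuous_const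
  have hsub : {z : ℂ | z.im ∈ Set.uIcc (-(Real.pi / 2)) (Real.pi / 2)} ⊆ U := by
    intro z hz
    rw [Set.mem_ofPred_eq, Set.uIcc_of_le (by linarith [Real.pi_pos]), Set.mem_Icc, ← abs_le] at hz
    exact hz.trans_lt hρ
  set H : ℂ → ℂ := fun z => 1 / (c + cexp (α * z)) with hH
  have hHd : DifferentiableOn ℂ H U := by
    refine DifferentiableOn.div (by fun_prop) (by fun_prop) fun z hz => ?_
    exact add_exp_mul_ne_zero hα hc (lt_of_lt_of_le hz (min_le_right _ _))
  rcases hm.eq_or_lt with rfl | hm0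
  · have h0 : (0 : ℝ) ^ α = 0 := Real.zero_rpow hα.1.ne'
    rw [h0, add_zero]
    refine tendsto_integral_stieltjesDensity_of_extension hα hc
      (q := fun z => H z - (1 / c : ℝ)) ((hHd.mono hsub).sub_const _) (fun z hz => ?_) (.inr rfl)
    simp [hH]
  · set z₀ : ℂ := (Real.log m : ℂ) with hz₀
    set E : ℂ → ℂ := fun z => cexp ((2 : ℝ) * z) with hE
    have hEz₀ : E z₀ = (m : ℂ) ^ 2 := by
      simp only [hE, hz₀]
      rw [← ofReal_mul, ← ofReal_exp, mul_comm, Real.exp_mul, Real.exp_log hm0]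
      norm_cast
    have hHz₀ : H z₀ = ((1 / (c + m ^ α) : ℝ) : ℂ) := by
      simp only [hH, hz₀]
      rw [← ofReal_mul, ← ofReal_exp, mul_comm, Real.exp_mul, Real.exp_log hm0]
      push_cast
      rfl
    have hz₀U : U ∈ 𝓝 z₀ := hUo.mem_nhds (by
      simp only [hU, hz₀, Set.mem_ofPred_eq, ofReal_im, abs_zero]
      linarith [Real.pi_pos])
    have hEne {z : ℂ} (hz : z ∈ U) : dslope E z₀ z ≠ 0 := by
      rcases eq_or_ne z z₀ with hzz | hne
      · have hd : HasDerivAt E (E z₀ * (2 : ℝ)) z₀ := by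
          simpa [hE] using ((hasDerivAt_id z₀).const_mul ((2 : ℝ) : ℂ)).cexp
        rw [hzz, dslope_same, hd.deriv]
        simp [hE]
      · rw [dslope_of_ne _ hne, slope_def_field]
        refine div_ne_zero (fun h => hne ?_) (sub_ne_zero.2 hne)
        obtain ⟨k, hk⟩ := exp_eq_exp_iff_exists_int.1 (sub_eq_zero.1 h)
        have him' : z.im = k * Real.pi := by
          have him := congrArg im hk
          have : 2 * z.im = k * (2 * Real.pi) := by simpa [hz₀] using him
          linarith
        have hzp : |z.im| < Real.pi := lt_of_lt_of_le hz (min_le_left _ _)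
        rw [him', abs_mul, abs_of_pos Real.pi_pos] at hzp
        have hk1 : |(k : ℝ)| < 1 := by nlinarith [Real.pi_pos]
        have hk0 : k = 0 := by
          rw [← Int.abs_lt_one_iff]
          exact_mod_cast hk1
        simpa [hk0] using hk
    -- The choice A = H(log m) cancels the simple zero of E - m² at log m; the quotient of `dslope`s
    -- is (H - A)/(E - m²) with that singularity removed.
    refine tendsto_integral_stieltjesDensity_of_extension hα hc
      (q := fun z => dslope H z₀ z / dslope E z₀ z * E z) ?_ (fun z hz => ?_) (.inl hm0.ne')
    · refine DifferentiableOn.mono ?_ hsub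
      exact (((Complex.differentiableOn_dslope hz₀U).2 hHd).div
        ((Complex.differentiableOn_dslope hz₀U).2 (by fun_prop)) fun z hz => hEne hz).mul
        (by fun_prop)
    · have hne : z ≠ z₀ := by
        rintro rfl
        exact hz hEz₀
      have hne' : z - z₀ ≠ 0 := sub_ne_zero.2 hne
      rw [dslope_of_ne _ hne, dslope_of_ne _ hne, slope_def_field, slope_def_field,
        div_div_div_cancel_right₀ hne', hHz₀, hEz₀]
      simp only [hH, hE]
      ring

lemma exists_measure_integral_eq {α c : ℝ} (hα : α ∈ Set.Ioc 0 2) (hc : 0 < c) :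
    ∃ μ : Measure ℝ, IsFiniteMeasure μ ∧ ∀ n : ℤ,
      ∫ y, Real.exp y ^ 2 / (Real.exp y ^ 2 + (n : ℝ) ^ 2) ∂μ = 1 / (c + |(n : ℝ)| ^ α) := by
  -- For α = 2, 1/(c + n²) is itself 1/c times the kernel at u = √c, that is y = (log c)/2.
  rcases hα.2.eq_or_lt with rfl | hα2
  · refine ⟨ENNReal.ofReal (1 / c) • Measure.dirac (Real.log c / 2), ?_, fun n => ?_⟩
    · exact Measure.smul_finite _ ENNReal.ofReal_ne_top
    · have h : Real.exp (Real.log c / 2) ^ 2 = c := by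
        rw [← Real.exp_nat_mul, Nat.cast_ofNat, mul_div_cancel₀ _ two_ne_zero, Real.exp_log hc]
      rw [integral_smul_measure, integral_dirac, h, ENNReal.toReal_ofReal (by positivity),
        Real.rpow_two, sq_abs, smul_eq_mul]
      field_simp
  have hα' : α ∈ Set.Ioo 0 2 := ⟨hα.1, hα2⟩
  have hnn := stieltjesDensity_nonneg c hα'
  have hcont := continuous_stieltjesDensity c hα'
  have hlim {m : ℝ} (hm : 0 ≤ m) : Integrable (fun y =>
      stieltjesDensity α c y * (Real.exp y ^ 2 / (Real.exp y ^ 2 + m ^ 2))) ∧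
      ∫ y, stieltjesDensity α c y * (Real.exp y ^ 2 / (Real.exp y ^ 2 + m ^ 2)) =
        1 / (c + m ^ α) := by
    have h := tendsto_integral_stieltjesDensity hα' hc hm
    have hc' : Continuous fun y =>
        stieltjesDensity α c y * (Real.exp y ^ 2 / (Real.exp y ^ 2 + m ^ 2)) :=
      hcont.mul (Continuous.div (by fun_prop) (by fun_prop) fun y => by positivity)
    -- Nonnegativity turns convergence of the symmetric integrals into integrability; the case m = 0
    -- then gives finite total mass.
    have hi := integrable_of_intervalIntegral_norm_tendsto (1 / (c + m ^ α))
      (fun R : ℝ => (hc'.integrableOn_Icc (a := -R) (b := R)).mono_set Set.Ioc_subset_Icc_self)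
      tendsto_neg_atTop_atBot tendsto_id (h.congr fun R => by
        refine intervalIntegral.integral_congr fun y _ => ?_
        exact (Real.norm_of_nonneg (mul_nonneg (hnn y) (by positivity))).symm)
    exact ⟨hi, tendsto_nhds_unique
      (intervalIntegral_tendsto_integral hi tendsto_neg_atTop_atBot tendsto_id) h⟩
  have hint : Integrable (stieltjesDensity α c) := by
    simpa using (hlim le_rfl).1
  refine ⟨volume.withDensity fun y => ENNReal.ofReal (stieltjesDensity α c y),
    isFiniteMeasure_withDensity_ofReal hint.2, fun n => ?_⟩
  rw [integral_withDensity_eq_integral_toReal_smul hcont.measurable.ennreal_ofReal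
    (.of_forall fun y => ENNReal.ofReal_lt_top), ← (hlim (abs_nonneg (n : ℝ))).2]
  simp_rw [ENNReal.toReal_ofReal (hnn _), smul_eq_mul, sq_abs]

theorem mainTheorem1 (α c : ℝ) (hα : α ∈ Set.Ioc (0 : ℝ) 2) (hc : 0 < c) :
    (∀ x ∈ Set.Ioo 0 Real.pi,
      Summable (fun n : ℤ => Real.cos (n * x) / (c + |(n : ℝ)| ^ α))
        (SummationFilter.conditional ℤ)) ∧
    IsCompletelyMonotoneOn (periodicGreen α c) (Set.Ioo 0 Real.pi) ∧
    ∀ p : ℕ, ∀ x ∈ Set.Ioo 0 Real.pi,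
      0 < (-1 : ℝ) ^ p * iteratedDeriv p (periodicGreen α c) x := by
  obtain ⟨μ, hμ, hμn⟩ := exists_measure_integral_eq hα hc
  have hμ0 : μ ≠ 0 := by
    rintro rfl
    have h := hμn 0
    simp [Real.zero_rpow hα.1.ne', hc.ne] at h
  have hsum {x : ℝ} (hx : x ∈ Set.Ioo 0 Real.pi) :
      HasSum (fun n : ℤ => Real.cos (n * x) / (c + |(n : ℝ)| ^ α))
        (2 * Real.pi * ∫ y, greenKernel 0 (Real.exp y) x ∂μ) (SummationFilter.conditional ℤ) := by
    simpa only [mul_one_div] using hasSum_conditional_cos_mul hμn hx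
  have hF (p : ℕ) : ∀ x ∈ Set.Ioo 0 Real.pi, HasDerivAt
      (fun x => ∫ y, greenKernel p (Real.exp y) x ∂μ)
      (∫ y, greenKernel (p + 1) (Real.exp y) x ∂μ) x :=
    fun x hx => hasDerivAt_integral_greenKernel μ p hx
  have hG : Set.EqOn (periodicGreen α c) (fun x => ∫ y, greenKernel 0 (Real.exp y) x ∂μ)
      (Set.Ioo 0 Real.pi) := by
    intro x hx
    rw [periodicGreen, (hsum hx).tsum_eq, ← mul_assoc, one_div_mul_cancel Real.two_pi_pos.ne',
      one_mul]
  have hpos (p : ℕ) : ∀ x ∈ Set.Ioo 0 Real.pi,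
      0 < (-1 : ℝ) ^ p * iteratedDeriv p (periodicGreen α c) x := by
    intro x hx
    rw [iteratedDeriv_eq_of_hasDerivAt
      (F := fun p x => ∫ y, greenKernel p (Real.exp y) x ∂μ) isOpen_Ioo hF hG p hx]
    exact neg_one_pow_mul_integral_greenKernel_pos μ hμ0 p hx
  refine ⟨fun x hx => (hsum hx).summable, ⟨?_, fun p x hx => (hpos p x hx).le⟩, hpos⟩
  exact (contDiffOn_infty_of_hasDerivAt
    (F := fun p x => ∫ y, greenKernel p (Real.exp y) x ∂μ) isOpen_Ioo hF).congr hG
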